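/- For $d\ge 1$ let $T_d=\operatorname{conv}(-\mathbb 1_d,e_1,\dots,e_d)\subseteq\mathbb R^d$ be the standard terminal simplex, where $e_1,\dots,e_d$ are the standard unit vectors and $\mathbb 1_d=(1,\dots,1)$. For $1\le i\le d$ let $$\mu_i(T_d)=\inf\{\mu\ge 0 : (\mu T_d+\mathbb Z^d)\cap U\ne\emptyset\text{ for every }(d-i)\text{-dimensional affine subspace }U\subseteq\mathbb R^d\}$$ be its $i$-th covering minimum with respect to the lattice $\mathbb Z^d$. Then for all integers $d$ and $i$ with $2\le i\le d$, $$\mu_i(T_d)\le \frac12+\sum_{j=0}^{i-2}\frac{d-j}{d-j+1}.$$ Moreover, the right-hand side is itself one of the factors $\mu$ over which the infimum is taken (so, in particular, the set of these factors is nonempty). -/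

import Mathlib

open scoped Pointwise

noncomputable section

namespace CoveringMinima

/-- The dilation factors `μ ≥ 0` for which `μ K + Λ` meets every affine subspace of codimension `i`
(that is, of dimension `d - i` in a `d`-dimensional space). The empty affine subspace is excluded
explicitly, and the dimension condition is written without truncated subtraction. -/
def coveringFactors {E : Type*} [AddCommGroup E] [Module ℝ E]
    (i : ℕ) (K : Set E) (Λ : Submodule ℤ E) : Set ℝ :=
  {μ | 0 ≤ μ ∧ ∀ U : AffineSubspace ℝ E, (U : Set E).Nonempty →
    Module.finrank ℝ U.direction + i = Module.finrank ℝ E →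
      ((μ • K + (Λ : Set E)) ∩ (U : Set E)).Nonempty}

/-- The `i`-th covering minimum of `K` with respect to `Λ`: the smallest (in general: the infimum)
of the factors `μ ≥ 0` such that `μ K + Λ` meets every affine subspace of codimension `i`. -/
def coveringMinimum {E : Type*} [AddCommGroup E] [Module ℝ E]
    (i : ℕ) (K : Set E) (Λ : Submodule ℤ E) : ℝ :=
  sInf (coveringFactors i K Λ)

/-- The standard lattice `ℤ^d` in `ℝ^d`. -/
def integerLattice (d : ℕ) : Submodule ℤ (Fin d → ℝ) :=
  Submodule.span ℤ (Set.range (Pi.basisFun ℝ (Fin d)))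

/-- The standard terminal simplex `T_d = conv(-𝟙, e_1, …, e_d)` in `ℝ^d`. -/
def terminalSimplex (d : ℕ) : Set (Fin d → ℝ) :=
  convexHull ℝ (insert (fun _ => -1) (Set.range fun j : Fin d => Pi.single j 1))

end CoveringMinima

end

/-!
The proof is an induction on the codimension `i`, lowering the dimension `d` at the same time.

Codimension one. A hyperplane is a level set of a nonzero functional `φ`. The vertices of `T_d` sum to
zero and span, so `φ` takes values `a < 0 < b` at two of them. On half the edge joining these
vertices `φ` fills the interval `[a / 2, b / 2]`, whose length is at least `min (-a) b`, and the
vertices are lattice points; so translating along one of them reaches every level. Hence `1 / 2` is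
a covering factor (`half_mem_coveringFactors_one`).

Raising the codimension. If `μ` is a factor for `(n, i)`, then `μ + (n + 1) / (n + 2)` is one for
`(n + 1, i + 1)` (`add_mem_coveringFactors_succ`). A proper subspace `U` of `ℝ^(n+1)` is not parallel
to some `e_k`. Deleting the `k`-th coordinate maps `T_(n+1)` onto `T_n`, `ℤ^(n+1)` onto `ℤ^n`, and `U`
to a subspace of the same dimension, so some point of `U` lies in `μ T_(n+1) + s e_k + ℤ^(n+1)`, where
`s` only matters modulo `1`. For `0 ≤ s < 1`, either `s e_k ∈ s T_(n+1)` is good enough, or one uses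
`(s - 1) e_k ∈ (n + 1) (1 - s) T_(n+1)`, which holds because `-e_k` is the sum of the other `n + 1`
vertices. The smaller of `s` and `(n + 1) (1 - s)` is at most `(n + 1) / (n + 2)`.
-/

open scoped Pointwise

namespace CoveringMinima

theorem mem_integerLattice_iff {d : ℕ} {x : Fin d → ℝ} :
    x ∈ integerLattice d ↔ ∀ j, ∃ m : ℤ, (m : ℝ) = x j := by
  rw [integerLattice, Module.Basis.mem_span_iff_repr_mem]
  simp

theorem neg_one_mem_terminalSimplex (d : ℕ) : (fun _ => -1) ∈ terminalSimplex d :=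
  subset_convexHull ℝ _ (Set.mem_insert _ _)

theorem single_mem_terminalSimplex {d : ℕ} (j : Fin d) : Pi.single j 1 ∈ terminalSimplex d :=
  subset_convexHull ℝ _ (Set.mem_insert_of_mem _ ⟨j, rfl⟩)

theorem neg_one_mem_integerLattice (d : ℕ) : (fun _ => -1) ∈ integerLattice d :=
  mem_integerLattice_iff.2 fun _ => ⟨-1, by simp⟩

theorem single_mem_integerLattice {d : ℕ} (j : Fin d) :
    (Pi.single j 1 : Fin d → ℝ) ∈ integerLattice d :=
  Submodule.subset_span ⟨j, by simp⟩

/-- The parameter `t` is the weight of the vertex `-𝟙`, and `x j + t` that of the vertex `e_j`. -/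
theorem exists_of_mem_smul_terminalSimplex {d : ℕ} {μ : ℝ} (hμ : 0 ≤ μ) {x : Fin d → ℝ}
    (hx : x ∈ μ • terminalSimplex d) :
    ∃ t : ℝ, 0 ≤ t ∧ (∀ j, 0 ≤ x j + t) ∧ ∑ j, x j + (d + 1) * t = μ := by
  obtain ⟨y, hy, rfl⟩ := hx
  have key : terminalSimplex d ⊆
      {y | ∃ t : ℝ, 0 ≤ t ∧ (∀ j, 0 ≤ y j + t) ∧ ∑ j, y j + (d + 1) * t = 1} := by
    refine convexHull_min ?_ ?_
    · rintro y (rfl | ⟨j, rfl⟩)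
      · exact ⟨1, by simp, by simp, by simp⟩
      · refine ⟨0, le_rfl, fun l => ?_, by simp⟩
        rw [add_zero]
        exact (Pi.single_nonneg.2 zero_le_one : (0 : Fin d → ℝ) ≤ Pi.single j 1) l
    · rintro y ⟨t, ht, hy, hyt⟩ y' ⟨t', ht', hy', hyt'⟩ a b ha hb hab
      refine ⟨a * t + b * t', by positivity, fun j => ?_, ?_⟩
      · have := mul_nonneg ha (hy j)
        have := mul_nonneg hb (hy' j)
        simp only [Pi.add_apply, Pi.smul_apply, smul_eq_mul]
        linarith
      · simp only [Pi.add_apply, Pi.smul_apply, smul_eq_mul, Finset.sum_add_distrib,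
          ← Finset.mul_sum]
        linear_combination a * hyt + b * hyt' + hab
  obtain ⟨t, ht, h, hsum⟩ := key hy
  refine ⟨μ * t, by positivity, fun j => ?_, ?_⟩
  · have := mul_nonneg hμ (h j)
    simp only [Pi.smul_apply, smul_eq_mul]
    linarith
  · simp only [Pi.smul_apply, smul_eq_mul, ← Finset.mul_sum]
    linear_combination μ * hsum

/-- Nonnegative weights of total at most `μ` suffice: since the vertices sum to zero, the missing
weight can be spread evenly over all of them. -/
theorem mem_smul_terminalSimplex {d : ℕ} {μ : ℝ} {x : Fin d → ℝ} {t : ℝ} (ht : 0 ≤ t)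
    (hx : ∀ j, 0 ≤ x j + t) (hsum : ∑ j, x j + (d + 1) * t ≤ μ) :
    x ∈ μ • terminalSimplex d := by
  obtain ⟨t, ht, hx, hsum⟩ :
      ∃ t : ℝ, 0 ≤ t ∧ (∀ j, 0 ≤ x j + t) ∧ ∑ j, x j + (d + 1) * t = μ := by
    have hd : (0 : ℝ) < d + 1 := by positivity
    have h : 0 ≤ (μ - (∑ j, x j + (d + 1) * t)) / (d + 1) := div_nonneg (by linarith) hd.le
    refine ⟨t + (μ - (∑ j, x j + (d + 1) * t)) / (d + 1), by positivity,
      fun j => by linarith [hx j], ?_⟩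
    field_simp
    ring
  have hμ : ∑ j, (x j + t) + t = μ := by
    rw [← hsum, Finset.sum_add_distrib]
    simp
    ring
  have hnn : 0 ≤ ∑ j, (x j + t) := Finset.sum_nonneg fun j _ => hx j
  rcases (show 0 ≤ μ by linarith).eq_or_lt with h0 | hpos
  · have ht0 : t = 0 := by linarith
    have hx0 : x = 0 := by
      ext j
      have := (Finset.sum_eq_zero_iff_of_nonneg fun j _ => hx j).1
        (show ∑ j, (x j + t) = 0 by linarith) j (Finset.mem_univ j)
      simpa [ht0] using this
    rw [← h0, hx0]
    exact ⟨_, neg_one_mem_terminalSimplex d, by simp⟩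
  · rw [Set.mem_smul_set_iff_inv_smul_mem₀ hpos.ne']
    have hmem := (convex_convexHull ℝ
      (insert (fun _ => -1) (Set.range fun j : Fin d => (Pi.single j 1 : Fin d → ℝ)))).sum_mem
      (t := (Finset.univ : Finset (Option (Fin d))))
      (w := fun o => o.elim (μ⁻¹ * t) fun j => μ⁻¹ * (x j + t))
      (z := fun o => o.elim (fun _ => -1) fun j => Pi.single j 1)
      (by
        rintro (_ | j) -
        · exact mul_nonneg (inv_nonneg.2 hpos.le) ht
        · exact mul_nonneg (inv_nonneg.2 hpos.le) (hx j))
      (by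
        simp only [Fintype.sum_option, Option.elim, ← Finset.mul_sum]
        field_simp
        linarith)
      (by
        rintro (_ | j) -
        · exact neg_one_mem_terminalSimplex d
        · exact single_mem_terminalSimplex j)
    rw [Fintype.sum_option] at hmem
    have heq : μ⁻¹ • x = (μ⁻¹ * t) • (fun _ => -1) +
        ∑ j, (μ⁻¹ * (x j + t)) • (Pi.single j 1 : Fin d → ℝ) := by
      ext l
      simp [Finset.sum_apply, Pi.single_apply]
      ring
    rw [heq]
    exact hmem

/-- The interval `[a / 2, b / 2]` is at least as long as the step `|a|`, so its translates by
multiples of `a` cover the line. -/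
theorem exists_int_eq_half_segment_add {a b : ℝ} (ha : a < 0) (hab : -a ≤ b) (c : ℝ) :
    ∃ (m : ℤ) (θ : ℝ), 0 ≤ θ ∧ θ ≤ 1 ∧ c = 1 / 2 * ((1 - θ) * a + θ * b) + m * a := by
  obtain ⟨m, hm, -⟩ := existsUnique_add_zsmul_mem_Ico (neg_pos.2 ha) c (a / 2)
  simp only [zsmul_eq_mul, Set.mem_Ico] at hm
  have hd : 0 < b - a := by linarith
  refine ⟨m, (2 * (c + m * -a) - a) / (b - a), div_nonneg (by linarith) hd.le,
    (div_le_one hd).2 (by linarith), ?_⟩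
  field_simp
  ring

/-- Two lattice points of `T_d` strictly on opposite sides of the kernel of `φ` are enough: half
the segment joining them, translated along one of them, meets every level set of `φ`. -/
theorem exists_mem_half_smul_add_of_neg_of_pos {d : ℕ} (φ : (Fin d → ℝ) →ₗ[ℝ] ℝ)
    {p q : Fin d → ℝ} (hp : p ∈ terminalSimplex d) (hq : q ∈ terminalSimplex d)
    (hpl : p ∈ integerLattice d) (hql : q ∈ integerLattice d) (hφp : φ p < 0) (hφq : 0 < φ q)
    (c : ℝ) :
    ∃ x ∈ (1 / 2 : ℝ) • terminalSimplex d + (integerLattice d : Set (Fin d → ℝ)), φ x = c := by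
  wlog h : -φ p ≤ φ q generalizing φ p q c
  · obtain ⟨x, hx, hφx⟩ := this (-φ) hq hp hql hpl (by simpa using hφq) (by simpa using hφp) (-c)
      (by simpa using (not_le.1 h).le)
    exact ⟨x, hx, by simpa using hφx⟩
  obtain ⟨m, θ, hθ0, hθ1, hc⟩ := exists_int_eq_half_segment_add hφp h c
  refine ⟨(1 / 2 : ℝ) • ((1 - θ) • p + θ • q) + m • p, Set.add_mem_add (Set.smul_mem_smul_set ?_)
    ((integerLattice d).smul_mem m hpl), ?_⟩
  · exact convex_convexHull ℝ _ hp hq (by linarith) hθ0 (by ring)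
  · rw [hc]
    simp [← Int.cast_smul_eq_zsmul ℝ]
    ring

theorem exists_mem_half_smul_add_of_ne_zero {d : ℕ} {φ : (Fin d → ℝ) →ₗ[ℝ] ℝ} (hφ : φ ≠ 0)
    (c : ℝ) :
    ∃ x ∈ (1 / 2 : ℝ) • terminalSimplex d + (integerLattice d : Set (Fin d → ℝ)), φ x = c := by
  obtain ⟨j, hj⟩ : ∃ j, φ (Pi.single j 1) ≠ 0 := by
    by_contra! h
    exact hφ ((Pi.basisFun ℝ (Fin d)).ext fun j => by simpa using h j)
  wlog hpos : 0 < φ (Pi.single j 1) generalizing φ c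
  · obtain ⟨x, hx, hφx⟩ := this (neg_ne_zero.2 hφ) (-c) (by simpa using hj)
      (by simpa using lt_of_le_of_ne (not_lt.1 hpos) hj)
    exact ⟨x, hx, by simpa using hφx⟩
  by_cases h : ∃ l, φ (Pi.single l 1) < 0
  · obtain ⟨l, hl⟩ := h
    exact exists_mem_half_smul_add_of_neg_of_pos φ (single_mem_terminalSimplex l)
      (single_mem_terminalSimplex j) (single_mem_integerLattice l) (single_mem_integerLattice j)
      hl hpos c
  · push Not at h
    refine exists_mem_half_smul_add_of_neg_of_pos φ (neg_one_mem_terminalSimplex d)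
      (single_mem_terminalSimplex j) (neg_one_mem_integerLattice d) (single_mem_integerLattice j)
      ?_ hpos c
    have hsum : (fun _ => -1 : Fin d → ℝ) = -∑ l, Pi.single l 1 := by
      ext l
      simp [Finset.sum_apply, Pi.single_apply]
    rw [hsum, map_neg, map_sum, neg_lt_zero]
    exact Finset.sum_pos' (fun l _ => h l) ⟨j, Finset.mem_univ j, hpos⟩

theorem half_mem_coveringFactors_one (d : ℕ) :
    (1 / 2 : ℝ) ∈ coveringFactors 1 (terminalSimplex d) (integerLattice d) := by
  refine ⟨by norm_num, fun U ⟨u, hu⟩ hU => ?_⟩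
  have hlt : U.direction < ⊤ := lt_top_iff_ne_top.2 fun h => by
    rw [h, finrank_top] at hU
    omega
  obtain ⟨φ, hφ, hle⟩ := Submodule.exists_le_ker_of_lt_top _ hlt
  have hker : U.direction = LinearMap.ker φ := by
    refine Submodule.eq_of_le_of_finrank_le hle ?_
    have := Module.Dual.finrank_ker_add_one_of_ne_zero hφ
    omega
  obtain ⟨x, hx, hφx⟩ := exists_mem_half_smul_add_of_ne_zero hφ (φ u)
  refine ⟨x, hx, ?_⟩
  have hxu : x -ᵥ u ∈ U.direction := by
    rw [hker, LinearMap.mem_ker, vsub_eq_sub, map_sub, hφx, sub_self]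
  exact (AffineSubspace.vsub_right_mem_direction_iff_mem hu x).1 hxu

/-- Deleting the `k`-th coordinate keeps the dimension of a subspace not containing `e_k`. -/
theorem finrank_map_funLeft_succAbove {n : ℕ} {k : Fin (n + 1)}
    {W : Submodule ℝ (Fin (n + 1) → ℝ)} (hk : Pi.single k 1 ∉ W) :
    Module.finrank ℝ (W.map (LinearMap.funLeft ℝ ℝ k.succAbove)) = Module.finrank ℝ W := by
  set π := LinearMap.funLeft ℝ ℝ k.succAbove
  have hinj : Function.Injective (π.domRestrict W) := by
    rw [← LinearMap.ker_eq_bot, LinearMap.ker_eq_bot']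
    rintro ⟨w, hw⟩ h
    have hw' : w = w k • (Pi.single k 1 : Fin (n + 1) → ℝ) := by
      ext j
      rcases Fin.eq_self_or_eq_succAbove k j with rfl | ⟨j, rfl⟩
      · simp
      · simpa [π, LinearMap.funLeft_apply, Fin.succAbove_ne] using congrFun h j
    have hwk : w k = 0 := by
      by_contra hne
      rw [hw'] at hw
      exact hk ((W.smul_mem_iff hne).1 hw)
    rw [hwk, zero_smul] at hw'
    exact Subtype.ext hw'
  rw [← LinearMap.range_domRestrict, LinearMap.finrank_range_of_inj hinj]

/-- If deleting the `k`-th coordinate of `x` leaves a point of `μ T_n`, then moving `x` along the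
lattice direction `e_k` brings it into `(μ + (n + 1) / (n + 2)) T_(n+1)`. -/
theorem exists_int_add_smul_single_mem {n : ℕ} {μ : ℝ} (hμ : 0 ≤ μ) (k : Fin (n + 1))
    (x : Fin (n + 1) → ℝ) (hx : (fun j => x (k.succAbove j)) ∈ μ • terminalSimplex n) :
    ∃ m : ℤ, x + (m : ℝ) • Pi.single k 1 ∈
      (μ + (n + 1) / (n + 2) : ℝ) • terminalSimplex (n + 1) := by
  obtain ⟨t, ht, hxt, hsum⟩ := exists_of_mem_smul_terminalSimplex hμ hx
  -- `x` is the point of `μ T_(n+1)` with weight `0` at `e_k`, moved by `x k + t` along `e_k`.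
  set s := x k + t with hs
  have hf0 := Int.fract_nonneg s
  have hf1 := Int.fract_lt_one s
  have hfl := Int.floor_add_fract s
  have hn : (0 : ℝ) < n + 2 := by positivity
  by_cases hf : Int.fract s ≤ (n + 1) / (n + 2)
  · refine ⟨-⌊s⌋, mem_smul_terminalSimplex ht (fun j => ?_) ?_⟩
    · rcases Fin.eq_self_or_eq_succAbove k j with rfl | ⟨j, rfl⟩
      · simp
        linarith
      · simpa [Fin.succAbove_ne] using hxt j
    · rw [Fin.sum_univ_succAbove _ k]
      simp [Fin.succAbove_ne]
      linarith
  · have hf' : (n + 1) * (1 - Int.fract s) ≤ (n + 1) / (n + 2) := by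
      rw [not_le, div_lt_iff₀ hn] at hf
      rw [le_div_iff₀ hn]
      nlinarith
    refine ⟨-⌊s⌋ - 1, mem_smul_terminalSimplex (t := t + (1 - Int.fract s)) (by linarith)
      (fun j => ?_) ?_⟩
    · rcases Fin.eq_self_or_eq_succAbove k j with rfl | ⟨j, rfl⟩
      · simp
        linarith
      · have := hxt j
        simp [Fin.succAbove_ne]
        linarith
    · rw [Fin.sum_univ_succAbove _ k]
      simp [Fin.succAbove_ne]
      linarith

theorem add_mem_coveringFactors_succ {n i : ℕ} {μ : ℝ}
    (hμ : μ ∈ coveringFactors i (terminalSimplex n) (integerLattice n)) :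
    μ + (n + 1) / (n + 2) ∈
      coveringFactors (i + 1) (terminalSimplex (n + 1)) (integerLattice (n + 1)) := by
  obtain ⟨hμ0, hμ⟩ := hμ
  refine ⟨by positivity, fun U hne hU => ?_⟩
  rw [Module.finrank_fin_fun] at hU
  obtain ⟨k, hk⟩ : ∃ k, Pi.single k 1 ∉ U.direction := by
    by_contra! h
    have htop : U.direction = ⊤ := by
      rw [eq_top_iff, ← (Pi.basisFun ℝ (Fin (n + 1))).span_eq, Submodule.span_le]
      rintro _ ⟨k, rfl⟩
      simpa using h k
    rw [htop, finrank_top, Module.finrank_fin_fun] at hU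
    omega
  set π : (Fin (n + 1) → ℝ) →ₗ[ℝ] Fin n → ℝ := LinearMap.funLeft ℝ ℝ k.succAbove
  obtain ⟨_, ⟨y, hy, z, hz, hyz⟩, u, hu, rfl⟩ := hμ (U.map π.toAffineMap)
    (by simpa using hne) (by
      rw [AffineSubspace.map_direction, LinearMap.toAffineMap_linear,
        finrank_map_funLeft_succAbove hk, Module.finrank_fin_fun]
      omega)
  have hz := mem_integerLattice_iff.1 hz
  -- The lattice point `z` is lifted with `k`-th coordinate `0`.
  set v : Fin (n + 1) → ℝ := k.insertNth 0 z
  have hv : v ∈ integerLattice (n + 1) := by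
    refine mem_integerLattice_iff.2 fun j => ?_
    rcases Fin.eq_self_or_eq_succAbove k j with rfl | ⟨j, rfl⟩
    · exact ⟨0, by simp [v]⟩
    · simpa [v] using hz j
  have huv : (fun j => (u - v) (k.succAbove j)) = y := by
    ext j
    have := congrFun hyz j
    simp [π, LinearMap.funLeft_apply] at this
    simp [v]
    linarith
  obtain ⟨m, hm⟩ := exists_int_add_smul_single_mem hμ0 k (u - v) (huv ▸ hy)
  refine ⟨u, ⟨_, hm, v - m • Pi.single k 1,
    sub_mem hv ((integerLattice _).smul_mem m (single_mem_integerLattice k)), ?_⟩, hu⟩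
  simp only [← Int.cast_smul_eq_zsmul ℝ]
  abel

theorem bound_mem_coveringFactors (r : ℕ) : ∀ d : ℕ, r + 1 ≤ d →
    (1 / 2 + ∑ j ∈ Finset.range r, ((d : ℝ) - j) / ((d : ℝ) - j + 1)) ∈
      coveringFactors (r + 1) (terminalSimplex d) (integerLattice d) := by
  induction r with
  | zero => exact fun d _ => by simpa using half_mem_coveringFactors_one d
  | succ r ih =>
    rintro (_ | n) hd
    · omega
    · convert add_mem_coveringFactors_succ (ih n (by omega)) using 1
      rw [Finset.sum_range_succ', ← add_assoc]
      congr 1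
      · congr 1
        refine Finset.sum_congr rfl fun j _ => ?_
        push_cast
        congr 1 <;> ring
      · push_cast
        congr 1 <;> ring

end CoveringMinima

theorem mainTheorem6 (d i : ℕ) (hi : 2 ≤ i) (hid : i ≤ d) :
    (1 / 2 + ∑ j ∈ Finset.range (i - 1), ((d : ℝ) - j) / ((d : ℝ) - j + 1)) ∈
        CoveringMinima.coveringFactors i (CoveringMinima.terminalSimplex d)
          (CoveringMinima.integerLattice d) ∧
      CoveringMinima.coveringMinimum i (CoveringMinima.terminalSimplex d)
          (CoveringMinima.integerLattice d) ≤
        1 / 2 + ∑ j ∈ Finset.range (i - 1), ((d : ℝ) - j) / ((d : ℝ) - j + 1) := by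
  have h := CoveringMinima.bound_mem_coveringFactors (i - 1) d (by omega)
  rw [Nat.sub_add_cancel (by omega : 1 ≤ i)] at h
  exact ⟨h, csInf_le ⟨0, fun _ hμ => hμ.1⟩ h⟩
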